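/- Let $p$ be a prime, $q=p^t$, let $r\ge 2$ be an integer, and let $\mathbb S$ be the set of elements of $\mathbb F_{q^r}$ of degree $r$ over $\mathbb F_q$. For $\alpha\in\mathbb S$ let $A(\alpha)=\{a\alpha+b : a,b\in\mathbb F_q,\ a\neq 0\}$ be the affine set containing $\alpha$. Let $\sigma:\alpha\mapsto\alpha^q$ be the Frobenius automorphism of $\mathbb F_{q^r}$ over $\mathbb F_q$; the group $\langle\sigma\rangle$ acts on the set $\mathbb A=\{A(\alpha):\alpha\in\mathbb S\}$. Let $\mu$ be the Möbius function and $\phi$ Euler's function. Then the following hold. 1. The number of affine sets in $\mathbb A$ fixed by $\langle\sigma^{r}\rangle$ is $\dfrac{|\mathbb S|}{q^2-q}$. Now let $r_1$ be a positive divisor of $r$ and put $\bar r_1=r/r_1$. 2. Suppose $\bar r_1>1$ and $\bar r_1\mid q-1$. Then there are elements $\zeta\in\mathbb F_q^*$ of order $\bar r_1$. For every such $\zeta$, let $T(r)\subset\mathbb F_{q^r}$ be the set of all roots of the irreducible factors of degree $r$ of $x^{q^{r_1}-1}-\zeta$ in $\mathbb F_q[x]$. Then the number of affine sets fixed by $\langle\sigma^{r_1}\rangle$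 is $\dfrac{\phi(\bar r_1)\,|T(r)|}{q-1}$, and $$|T(r)|=\sum_{d\mid r_1,\ \gcd(d,\bar r_1)=1}\mu(d)\left(q^{r_1/d}-1\right).$$ 3. Suppose $\gcd(\bar r_1,r)=p$. (a) If $\bar r_1=p$, let $U(r)\subset\mathbb F_{q^r}$ be the set of all roots of the irreducible factors of degree $r$ of $x^{q^{r_1}}-x-1$ in $\mathbb F_q[x]$. Then the number of affine sets fixed by $\langle\sigma^{r_1}\rangle$ is $\dfrac{|U(r)|}{q}$, and $$|U(r)|=\sum_{d\mid r_1,\ p\nmid d}\mu(d)\,q^{r_1/d}.$$ (b) If $\bar r_1=r$, then exactly one affine set is fixed by $\langle\sigma^{r_1}\rangle$. -/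

import Mathlib

open Polynomial

namespace GoppaAffine

section

variable (K L : Type*) [Field K] [Field L] [Algebra K L]

/-- The set `𝕊` of all elements of `L` whose degree over `K` is the full degree `[L : K]`. -/
def fullDegree : Set L :=
  {α | (minpoly K α).natDegree = Module.finrank K L}

/-- The affine set `A(α) = {a α + b : a, b ∈ K, a ≠ 0}`. -/
def affineSet {L : Type*} [Field L] [Algebra K L] (α : L) : Set L :=
  {x | ∃ a b : K, a ≠ 0 ∧ x = algebraMap K L a * α + algebraMap K L b}

/-- The set `𝔸 = {A(α) : α ∈ 𝕊}` of all affine sets. -/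
def affineSets : Set (Set L) :=
  {X | ∃ α ∈ fullDegree K L, X = affineSet K α}

/-- All roots in `L` of those irreducible factors of `F ∈ K[x]` that have degree `[L : K]`
(for finite fields `L` contains every root of such a factor). -/
def rootsOfFactors (F : K[X]) : Set L :=
  {α | ∃ g : K[X], Irreducible g ∧ g.natDegree = Module.finrank K L ∧ g ∣ F ∧ aeval α g = 0}

variable [Fintype K] [FiniteDimensional K L]

/-- The Frobenius automorphism `σ : α ↦ α ^ q` of `L` over `K`, where `q = |K|`. -/
noncomputable def frob : Gal(L/K) :=
  FiniteField.frobeniusAlgEquivOfAlgebraic K L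

theorem frob_apply (α : L) : frob K L α = α ^ Fintype.card K := rfl

/-- The affine sets that are fixed (setwise) by every element of the group `⟨σ ^ s⟩`. -/
def fixedAffineSets (s : ℕ) : Set (Set L) :=
  {X | X ∈ affineSets K L ∧ ∀ τ ∈ Subgroup.zpowers (frob K L ^ s), τ '' X = X}

/-- The set `T(r)`, `r = [L : K]`: the roots of the irreducible factors of degree `r`
of `x ^ (q ^ s - 1) - ζ`. -/
def setT (s : ℕ) (ζ : Kˣ) : Set L :=
  rootsOfFactors K L (X ^ (Fintype.card K ^ s - 1) - C (ζ : K))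

/-- The set `U(r)`, `r = [L : K]`: the roots of the irreducible factors of degree `r`
of `x ^ (q ^ s) - x - 1`. -/
def setU (s : ℕ) : Set L :=
  rootsOfFactors K L (X ^ (Fintype.card K ^ s) - X - 1)

end

end GoppaAffine

/-! If `σ ^ r₁` fixes `A(α)`, then `α ^ q ^ r₁ = a α + b`. Put `n = r / r₁ > 1`. When `a ≠ 1`,
shifting to the fixed point of the affine map leaves `y ^ q ^ r₁ = ζ y`, and full degree forces `ζ`
to have order exactly `n`. When `a = 1`, rescaling leaves `y ^ q ^ r₁ = y + 1`, which forces `n = 0`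
in `K` (`exists_normal_representative`). If `n ∣ q - 1` only scalings survive, and if `n = p` only
the translation does. Affine sets are then counted through the fibres of `α ↦ A(α)`: `q (q - 1)`
elements on `𝕊`, `q - 1` on the union of the `T(r)` over all `ζ` of order `n`, and `q` on `U(r)`.

The sizes of `T(r)` and `U(r)` come from Möbius inversion over subfields (`ncard_inter_fullDegree`).
The local counts (`ncard_inter_subfield`) concern `y ^ q ^ s = h(y)`, where `h` is linear and its
`n`-th compositional iterate is the identity. -/

namespace GoppaAffine

/-! ### Degree as length of the Frobenius orbit -/

section FrobeniusOrbits

variable (K L : Type*) [Field K] [Field L] [Algebra K L] [Fintype K] [FiniteDimensional K L]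

theorem frob_iterate_apply (k : ℕ) (x : L) : (frob K L)^[k] x = x ^ Fintype.card K ^ k :=
  congrFun (FiniteField.coe_frobeniusAlgEquivOfAlgebraic_iterate K L k) x

theorem frob_pow_apply (k : ℕ) (x : L) : (frob K L ^ k) x = x ^ Fintype.card K ^ k := by
  rw [AlgEquiv.coe_pow, frob_iterate_apply]

theorem pow_card_pow_finrank (x : L) : x ^ Fintype.card K ^ Module.finrank K L = x := by
  have : Finite L := Module.finite_of_finite K
  have := Fintype.ofFinite L
  rw [← Module.card_eq_pow_finrank, FiniteField.pow_card]

theorem minimalPeriod_dvd_iff (x : L) (k : ℕ) :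
    Function.minimalPeriod (frob K L) x ∣ k ↔ x ^ Fintype.card K ^ k = x := by
  rw [← Function.isPeriodicPt_iff_minimalPeriod_dvd, Function.IsPeriodicPt, Function.IsFixedPt,
    frob_iterate_apply]

theorem minimalPeriod_dvd_finrank (x : L) :
    Function.minimalPeriod (frob K L) x ∣ Module.finrank K L :=
  (minimalPeriod_dvd_iff K L x _).2 (pow_card_pow_finrank K L x)

/-- Full degree means that `x` is primitive, hence by Galois theory that its stabilizer is trivial.
As the Galois group is cyclic, generated by `σ`, this is the same as a full orbit under `σ`. -/
theorem mem_fullDegree_iff (x : L) :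
    x ∈ fullDegree K L ↔ Function.minimalPeriod (frob K L) x = Module.finrank K L := by
  have : Finite L := Module.finite_of_finite K
  have : IsGalois K L := inferInstance
  have hfix : ∀ g : Gal(L/K), g x = x ↔ g ∈ (IntermediateField.adjoin K {x}).fixingSubgroup := by
    intro g
    rw [IntermediateField.mem_fixingSubgroup_iff]
    constructor
    · intro hg y hy
      have hle : IntermediateField.adjoin K {x} ≤
          IntermediateField.fixedField (Subgroup.zpowers g) := by
        rw [IntermediateField.adjoin_simple_le_iff, IntermediateField.mem_fixedField_iff]
        intro f hf
        have : Subgroup.zpowers g ≤ MulAction.stabilizer (Gal(L/K)) x := by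
          rw [Subgroup.zpowers_le]
          exact hg
        exact this hf
      exact (IntermediateField.mem_fixedField_iff _ _).1 (hle hy) g (Subgroup.mem_zpowers g)
    · intro h
      exact h x (IntermediateField.mem_adjoin_simple_self K x)
  change (minpoly K x).natDegree = _ ↔ _
  rw [← Field.primitive_element_iff_minpoly_natDegree_eq]
  constructor
  · intro h
    refine Nat.dvd_antisymm (minimalPeriod_dvd_finrank K L x) ?_
    have h1 : (frob K L ^ Function.minimalPeriod (frob K L) x) x = x := by
      rw [frob_pow_apply, ← minimalPeriod_dvd_iff]
    rw [hfix, h, IntermediateField.fixingSubgroup_top, Subgroup.mem_bot] at h1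
    rw [← FiniteField.orderOf_frobeniusAlgEquivOfAlgebraic K L]
    exact orderOf_dvd_of_pow_eq_one h1
  · intro h
    have hbot : (IntermediateField.adjoin K {x}).fixingSubgroup = ⊥ := by
      rw [Subgroup.eq_bot_iff_forall]
      intro g hg
      obtain ⟨n, rfl⟩ := (FiniteField.bijective_frobeniusAlgEquivOfAlgebraic_pow K L).2 g
      rw [← hfix] at hg
      have h2 : x ^ Fintype.card K ^ n.1 = x := (frob_pow_apply K L n.1 x).symm.trans hg
      rw [← minimalPeriod_dvd_iff, h] at h2
      change FiniteField.frobeniusAlgEquivOfAlgebraic K L ^ n.1 = 1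
      rw [Nat.eq_zero_of_dvd_of_lt h2 n.2, pow_zero]
    rw [← IsGalois.fixedField_fixingSubgroup (IntermediateField.adjoin K {x}), hbot,
      IntermediateField.fixedField_bot]

omit [Fintype K] in
theorem mem_rootsOfFactors_iff (F : K[X]) (x : L) :
    x ∈ rootsOfFactors K L F ↔ x ∈ fullDegree K L ∧ aeval x F = 0 := by
  constructor
  · rintro ⟨g, hg, hdeg, hgF, hx⟩
    refine ⟨?_, aeval_eq_zero_of_dvd_aeval_eq_zero hgF hx⟩
    have h := minpoly.eq_of_irreducible hg hx
    rw [fullDegree, Set.mem_ofPred_eq, ← h, natDegree_mul_C, hdeg]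
    exact inv_ne_zero (leadingCoeff_ne_zero.2 hg.ne_zero)
  · rintro ⟨hx, hF⟩
    exact ⟨minpoly K x, minpoly.irreducible (IsIntegral.of_finite K x), hx, minpoly.dvd K x hF,
      minpoly.aeval K x⟩

end FrobeniusOrbits

/-! ### Solutions of `y ^ q ^ s = h(y)` and Möbius inversion -/

section Counting

variable {K : Type*} [Field K] [Fintype K]

theorem aeval_pow_card_pow {A : Type*} [CommRing A] [Algebra K A] (g : K[X]) (y : A) (s : ℕ) :
    aeval y g ^ Fintype.card K ^ s = aeval (y ^ Fintype.card K ^ s) g := by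
  have h : ∀ z : A, (FiniteField.frobeniusAlgHom K A ^ s) z = z ^ Fintype.card K ^ s := by
    intro z
    rw [AlgHom.coe_pow, FiniteField.coe_frobeniusAlgHom, pow_iterate]
  rw [← h, ← h, aeval_algHom_apply]

/-- The map `y ↦ y ^ q ^ s` commutes with `h`, whose coefficients lie in `K`, so repeating it
iterates `h`. -/
theorem pow_card_pow_mul {A : Type*} [CommRing A] [Algebra K A] (h : K[X]) (y : A) (s : ℕ)
    (hy : y ^ Fintype.card K ^ s = aeval y h) (n : ℕ) :
    y ^ Fintype.card K ^ (s * n) = aeval y (h.comp^[n] X) := by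
  have key : ∀ (n : ℕ) (z : A), aeval z (h.comp^[n] X) = (fun w => aeval w h)^[n] z := by
    intro n z
    have := iterate_comp_eval₂ (p := h) (q := X) (algebraMap K A) n z
    rw [eval₂_X] at this
    exact this
  induction n with
  | zero => simp
  | succ n ih =>
    rw [mul_add_one, pow_add, pow_mul, ih, aeval_pow_card_pow, hy, key, key,
      ← Function.iterate_succ_apply]

omit [Fintype K] in
theorem iterate_comp_mul_eq (h : K[X]) {n : ℕ} (hn : h.comp^[n] X = X) (d : ℕ) :
    (h.comp^[n * d] X) = X := by
  rw [Function.iterate_mul]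
  exact Function.iterate_fixed hn d

omit [Fintype K] in
theorem iterate_comp_iterate (h : K[X]) (a b : ℕ) :
    (h.comp^[a] X).comp^[b] X = h.comp^[a * b] X := by
  have key : ∀ (g : K[X]) (a : ℕ) (f : K[X]), (g.comp^[a] X).comp f = g.comp^[a] f := by
    intro g a f
    induction a with
    | zero => simp
    | succ a ih => rw [Function.iterate_succ_apply', comp_assoc, ih, Function.iterate_succ_apply']
  rw [Function.iterate_mul]
  congr 1
  funext f
  exact key h a f

variable {L : Type*} [Field L] [Algebra K L] [FiniteDimensional K L]

/-- `y ↦ y ^ q ^ s - h(y)` has `q ^ s` zeros in `L` if `h` has compositional order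
dividing `[L : K] / s` and degree at most one. -/
theorem ncard_pow_card_pow_eq_aeval (h : K[X]) (hdeg : h.natDegree ≤ 1) {s n : ℕ} (hs : s ≠ 0)
    (hsn : s * n ∣ Module.finrank K L) (hn : h.comp^[n] X = X) :
    {y : L | y ^ Fintype.card K ^ s = aeval y h}.ncard = Fintype.card K ^ s := by
  classical
  have : Finite L := Module.finite_of_finite K
  have := Fintype.ofFinite L
  set q := Fintype.card K with hq
  have hq1 : 1 < q := Fintype.one_lt_card
  set P : K[X] := X ^ q ^ s - h with hP
  have hqs : h.natDegree < q ^ s := hdeg.trans_lt (Nat.one_lt_pow hs hq1)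
  have hlt : h.natDegree < (X ^ q ^ s : K[X]).natDegree := by rwa [natDegree_X_pow]
  have hPdeg : P.natDegree = q ^ s := by
    rw [hP, natDegree_sub_eq_left_of_natDegree_lt hlt, natDegree_X_pow]
  have hP0 : P ≠ 0 := by
    rintro h0
    rw [h0, natDegree_zero] at hPdeg
    omega
  -- In `K[X] / (P)` the `q ^ s` power of the root is `h(root)`. The exponent `|L|` is `q ^ (s * (n
  -- * m))`, so raising to it applies `h` a multiple of `n` times, which is the identity. Thus `P`
  -- splits in `L` with distinct roots.
  have hdvd : P ∣ X ^ Fintype.card L - X := by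
    rw [← AdjoinRoot.mk_eq_zero, map_sub, map_pow, AdjoinRoot.mk_X, sub_eq_zero]
    have h1 : AdjoinRoot.root P ^ q ^ s = aeval (AdjoinRoot.root P) h := by
      have := AdjoinRoot.mk_self (f := P)
      rw [AdjoinRoot.aeval_eq, ← sub_eq_zero, ← AdjoinRoot.mk_X, ← map_pow, ← map_sub, this]
    obtain ⟨m, hm⟩ := hsn
    rw [Module.card_eq_pow_finrank (K := K), hm, mul_assoc, pow_card_pow_mul h _ s h1,
      iterate_comp_mul_eq h hn, aeval_X]
  have hdvd' : P.map (algebraMap K L) ∣ X ^ Fintype.card L - X := by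
    simpa using Polynomial.map_dvd (algebraMap K L) hdvd
  have hne : (X ^ Fintype.card L - X : L[X]) ≠ 0 :=
    FiniteField.X_pow_card_sub_X_ne_zero L Fintype.one_lt_card
  have hsplit : (X ^ Fintype.card L - X : L[X]).Splits := by
    rw [splits_iff_card_roots, FiniteField.roots_X_pow_card_sub_X,
      FiniteField.X_pow_card_sub_X_natDegree_eq L Fintype.one_lt_card]
    rfl
  have hnodup : (P.map (algebraMap K L)).roots.Nodup := by
    refine Multiset.nodup_of_le (roots.le_of_dvd hne hdvd') ?_
    rw [FiniteField.roots_X_pow_card_sub_X]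
    exact Finset.univ.nodup
  have hcard : Multiset.card (P.map (algebraMap K L)).roots = q ^ s := by
    rw [splits_iff_card_roots.1 (hsplit.of_dvd hne hdvd'), natDegree_map, hPdeg]
  have hset : {y : L | y ^ q ^ s = aeval y h} = ((P.map (algebraMap K L)).roots.toFinset : Set L) := by
    ext y
    rw [Set.mem_ofPred_eq, Finset.mem_coe, Multiset.mem_toFinset,
      mem_roots (map_ne_zero hP0), IsRoot.def, eval_map_algebraMap, hP, map_sub, map_pow, aeval_X,
      sub_eq_zero]
  rw [hset, Set.ncard_coe_finset, Multiset.toFinset_card_of_nodup hnodup, hcard]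

omit [Fintype K] in
theorem natDegree_iterate_comp_X_le_one (h : K[X]) (hdeg : h.natDegree ≤ 1) (e : ℕ) :
    (h.comp^[e] X).natDegree ≤ 1 := by
  induction e with
  | zero => exact natDegree_X_le
  | succ e ih =>
    rw [Function.iterate_succ_apply', natDegree_comp]
    exact Nat.mul_le_mul hdeg ih

/-- The elements of `{y | y ^ q ^ (s * d) = h(y)}` lying in the subfield of degree `s * n`. -/
theorem ncard_inter_subfield (h : K[X]) (hdeg : h.natDegree ≤ 1) {s n d : ℕ} (hs : s ≠ 0)
    (hsn : s * n ∣ Module.finrank K L) (hn : h.comp^[n] X = X) (hd : d.Coprime n) (hn1 : 1 < n) :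
    {y : L | y ^ Fintype.card K ^ (s * d) = aeval y h ∧
      y ^ Fintype.card K ^ (s * n) = y}.ncard = Fintype.card K ^ s := by
  -- Here `e` inverts `d` modulo `n`. On the subfield, raising to `q ^ (s * n)` is trivial, so the
  -- equation for `s * d` and `h` is equivalent to the one for `s` and the `e`-th iterate of `h`.
  obtain ⟨e, k, hde⟩ : ∃ e k, d * e = n * k + 1 := by
    obtain ⟨e, he⟩ := Nat.exists_mul_mod_eq_one_of_coprime hd hn1
    refine ⟨e, d * e / n, ?_⟩
    have := Nat.mod_add_div (d * e) n
    omega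
  have hen : (h.comp^[e] X).comp^[n] X = X := by
    rw [iterate_comp_iterate, mul_comm, iterate_comp_mul_eq h hn]
  rw [← ncard_pow_card_pow_eq_aeval (L := L) (h.comp^[e] X)
    (natDegree_iterate_comp_X_le_one h hdeg e) hs hsn hen]
  congr 1
  ext y
  simp only [Set.mem_ofPred_eq]
  constructor
  · rintro ⟨h1, h2⟩
    have h3 : y ^ Fintype.card K ^ (s * n * k) = y := by
      rw [← frob_iterate_apply K L, Function.iterate_mul]
      apply Function.iterate_fixed
      rw [frob_iterate_apply, h2]
    rw [← pow_card_pow_mul h y _ h1, mul_assoc, hde, mul_add_one, ← mul_assoc, pow_add, pow_mul, h3]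
  · intro h1
    constructor
    · rw [pow_card_pow_mul _ y s h1, iterate_comp_iterate, mul_comm, hde,
        Function.iterate_succ_apply', iterate_comp_mul_eq h hn, comp_X]
    · rw [pow_card_pow_mul _ y s h1, hen, aeval_X]

theorem sum_moebius_divisors (e : ℕ) :
    ∑ d ∈ e.divisors, ArithmeticFunction.moebius d = if e = 1 then 1 else 0 := by
  rw [← ArithmeticFunction.coe_mul_zeta_apply, ArithmeticFunction.moebius_mul_coe_zeta,
    ArithmeticFunction.one_apply]

/-- Divide `m` and `r₁` by their gcd to get coprime `a` and `b`. The hypothesis at `k = a` gives `n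
∣ a`, and then `e ∣ b`; coprimality passes to `e` and `n`. -/
theorem index_dvd_and_coprime {m r₁ n e : ℕ} (hm : m ≠ 0) (hn : n ≠ 0)
    (h : m * e = r₁ * n) (hmn : ∀ k, m ∣ r₁ * k → n ∣ k) : e ∣ r₁ ∧ e.Coprime n := by
  obtain ⟨a, b, hab, ha, hb⟩ := Nat.exists_coprime m r₁
  set g := Nat.gcd m r₁
  have hg : 0 < g := Nat.gcd_pos_of_pos_left _ (Nat.pos_of_ne_zero hm)
  obtain ⟨c, hc⟩ := hmn a ⟨b, by rw [ha, hb]; ring⟩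
  have h1 : b = c * e := by
    rw [ha, hb, hc] at h
    have : (n * g) * (c * e) = (n * g) * b := by linarith
    exact (Nat.eq_of_mul_eq_mul_left (by positivity) this).symm
  refine ⟨⟨c * g, by rw [hb, h1]; ring⟩, ?_⟩
  rw [h1, hc] at hab
  exact (hab.coprime_mul_right.coprime_mul_left_right).symm

/-- After exchanging sums, each `y` contributes the sum of `μ(d)` over `d ∣ e`, where `e` is the
index of its period in `r₁ * n`; this is `1` exactly when `e = 1`. The hypothesis on `B` confines
these `d` to divisors of `r₁` coprime to `n`. -/
theorem ncard_inter_fullDegree (B : Set L) {r₁ n : ℕ} (hr : r₁ * n = Module.finrank K L)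
    (hB : ∀ y ∈ B, ∀ k, y ^ Fintype.card K ^ (r₁ * k) = y → n ∣ k) :
    ((B ∩ fullDegree K L).ncard : ℤ) = ∑ d ∈ r₁.divisors with d.Coprime n,
      ArithmeticFunction.moebius d *
        ({y | y ∈ B ∧ y ^ Fintype.card K ^ (r₁ / d * n) = y}.ncard : ℤ) := by
  classical
  have : Finite L := Module.finite_of_finite K
  have := Fintype.ofFinite L
  have hpos : 0 < r₁ * n := hr ▸ Module.finrank_pos
  have hr0 : r₁ ≠ 0 := by rintro rfl; simp at hpos
  have hn0 : n ≠ 0 := by rintro rfl; simp at hpos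
  have hcard : ∀ Y : Set L, (({y | y ∈ B ∧ y ∈ Y} : Set L).ncard : ℤ) =
      ∑ y ∈ Finset.univ.filter (· ∈ B), if y ∈ Y then 1 else 0 := by
    intro Y
    rw [Finset.sum_boole, Finset.filter_filter, Set.ncard_eq_toFinset_card']
    congr 2
    ext
    simp only [Set.mem_toFinset, Set.mem_ofPred_eq, Finset.mem_filter, Finset.mem_univ, true_and]
  have h1 := hcard (fullDegree K L)
  change ((B ∩ fullDegree K L).ncard : ℤ) = _ at h1
  rw [h1]
  have h2 : ∀ d, ({y | y ∈ B ∧ y ^ Fintype.card K ^ (r₁ / d * n) = y}.ncard : ℤ) =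
      ∑ y ∈ Finset.univ.filter (· ∈ B), if y ^ Fintype.card K ^ (r₁ / d * n) = y then 1 else 0 :=
    fun d => hcard {y | y ^ Fintype.card K ^ (r₁ / d * n) = y}
  simp_rw [h2, Finset.mul_sum]
  rw [Finset.sum_comm]
  refine Finset.sum_congr rfl fun y hy => ?_
  rw [Finset.mem_filter] at hy
  set m := Function.minimalPeriod (frob K L) y with hm
  obtain ⟨e, he⟩ : m ∣ r₁ * n := hr ▸ minimalPeriod_dvd_finrank K L y
  have hme : m * e ≠ 0 := he ▸ hpos.ne'
  have hm0 : m ≠ 0 := left_ne_zero_of_mul hme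
  have he0 : e ≠ 0 := right_ne_zero_of_mul hme
  obtain ⟨her, hen⟩ := index_dvd_and_coprime hm0 hn0 he.symm fun k hk =>
    hB y hy.2 k ((minimalPeriod_dvd_iff K L y _).1 hk)
  have hS : y ∈ fullDegree K L ↔ e = 1 := by
    rw [mem_fullDegree_iff, ← hr, he, ← hm]
    constructor
    · intro h
      exact Nat.eq_of_mul_eq_mul_left (Nat.pos_of_ne_zero hm0) (h.symm.trans (mul_one m).symm)
    · rintro rfl
      rw [mul_one]
  rw [if_congr hS rfl rfl, ← sum_moebius_divisors e]
  simp_rw [mul_ite, mul_one, mul_zero]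
  rw [← Finset.sum_filter, Finset.filter_filter]
  refine Finset.sum_congr ?_ fun _ _ => rfl
  ext d
  rw [Finset.mem_filter, Nat.mem_divisors, Nat.mem_divisors, ← minimalPeriod_dvd_iff, ← hm]
  have hiff : d ∣ r₁ → (m ∣ r₁ / d * n ↔ d ∣ e) := by
    rintro ⟨c, hc⟩
    have hd0 : 0 < d := Nat.pos_of_ne_zero (by rintro rfl; simp at hc; exact hr0 hc)
    rw [hc, Nat.mul_div_cancel_left _ hd0, ← Nat.mul_dvd_mul_iff_left hd0, ← mul_assoc, ← hc, he,
      mul_comm d m, Nat.mul_dvd_mul_iff_left (Nat.pos_of_ne_zero hm0)]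
  constructor
  · rintro ⟨hde, -⟩
    have hdr := hde.trans her
    exact ⟨⟨hdr, hr0⟩, hen.coprime_dvd_left hde, (hiff hdr).2 hde⟩
  · rintro ⟨⟨hdr, -⟩, -, h⟩
    exact ⟨(hiff hdr).1 h, he0⟩

end Counting

end GoppaAffine
namespace GoppaAffine

/-! ### Scaling and translation equations: the sizes of `T(r)` and `U(r)` -/

section Eigen

variable {K L : Type*} [Field K] [Fintype K] [Field L] [Algebra K L]

theorem pow_card_pow_affine (c : K) (b : K) (x : L) (s : ℕ) :
    (algebraMap K L c * x + algebraMap K L b) ^ Fintype.card K ^ s =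
      algebraMap K L c * x ^ Fintype.card K ^ s + algebraMap K L b := by
  have := aeval_pow_card_pow (C c * X + C b) x s
  simpa using this

omit [Fintype K] in
theorem iterate_comp_C_mul_X (c : K) (k : ℕ) : (C c * X : K[X]).comp^[k] X = C (c ^ k) * X := by
  induction k with
  | zero => simp
  | succ k ih =>
    rw [Function.iterate_succ_apply', ih, mul_comp, C_comp, X_comp, pow_succ', C_mul, mul_assoc]

omit [Fintype K] in
theorem iterate_comp_X_add_C (b : K) (k : ℕ) : (X + C b : K[X]).comp^[k] X = X + C (k * b) := by
  induction k with
  | zero => simp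
  | succ k ih =>
    rw [Function.iterate_succ_apply', ih, add_comp, C_comp, X_comp, add_assoc, ← C_add]
    push_cast
    ring_nf

theorem pow_card_pow_mul_of_eigen {c : K} {y : L} {s : ℕ}
    (hy : y ^ Fintype.card K ^ s = algebraMap K L c * y) (k : ℕ) :
    y ^ Fintype.card K ^ (s * k) = algebraMap K L (c ^ k) * y := by
  rw [pow_card_pow_mul (C c * X) y s (by simpa using hy), iterate_comp_C_mul_X]
  simp

theorem pow_card_pow_mul_of_translate {b : K} {y : L} {s : ℕ}
    (hy : y ^ Fintype.card K ^ s = y + algebraMap K L b) (k : ℕ) :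
    y ^ Fintype.card K ^ (s * k) = y + algebraMap K L (k * b) := by
  rw [pow_card_pow_mul (X + C b) y s (by simpa using hy), iterate_comp_X_add_C]
  simp

theorem pow_eq_one_of_eigen {c : K} {y : L} (hy0 : y ≠ 0) {s k : ℕ}
    (hy : y ^ Fintype.card K ^ s = algebraMap K L c * y)
    (hk : y ^ Fintype.card K ^ (s * k) = y) : c ^ k = 1 := by
  rw [pow_card_pow_mul_of_eigen hy] at hk
  apply (algebraMap K L).injective
  rw [map_one]
  exact (mul_eq_right₀ hy0).1 hk

theorem natCast_mul_eq_zero_of_translate {b : K} {y : L} {s k : ℕ}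
    (hy : y ^ Fintype.card K ^ s = y + algebraMap K L b)
    (hk : y ^ Fintype.card K ^ (s * k) = y) : (k : K) * b = 0 := by
  rw [pow_card_pow_mul_of_translate hy, add_eq_left] at hk
  exact (map_eq_zero _).1 hk

variable [FiniteDimensional K L]

theorem mem_setT_iff {s : ℕ} (hs : s ≠ 0) (ζ : Kˣ) (y : L) :
    y ∈ setT K L s ζ ↔ (y ≠ 0 ∧ y ^ Fintype.card K ^ s = algebraMap K L ζ * y) ∧
      y ∈ fullDegree K L := by
  have hq : 1 < Fintype.card K ^ s := Nat.one_lt_pow hs Fintype.one_lt_card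
  have hζ : algebraMap K L ζ ≠ 0 := (_root_.map_ne_zero _).2 ζ.ne_zero
  rw [setT, mem_rootsOfFactors_iff, and_comm, and_congr_left_iff]
  intro _
  rw [map_sub, map_pow, aeval_X, aeval_C, sub_eq_zero]
  have hpow : y ^ Fintype.card K ^ s = y ^ (Fintype.card K ^ s - 1) * y := by
    rw [← pow_succ, Nat.sub_add_cancel hq.le]
  constructor
  · intro h
    refine ⟨?_, by rw [hpow, h]⟩
    rintro rfl
    rw [zero_pow (by omega)] at h
    exact hζ h.symm
  · rintro ⟨h0, h⟩
    exact mul_right_cancel₀ h0 (hpow ▸ h)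

theorem mem_setU_iff (s : ℕ) (y : L) :
    y ∈ setU K L s ↔ y ^ Fintype.card K ^ s = y + 1 ∧ y ∈ fullDegree K L := by
  rw [setU, mem_rootsOfFactors_iff, and_comm, and_congr_left_iff]
  intro _
  rw [map_sub, map_sub, map_pow, aeval_X, map_one, sub_sub, sub_eq_zero]

theorem ncard_setT {r₁ n : ℕ} (hr : r₁ * n = Module.finrank K L) (hn : 1 < n) (ζ : Kˣ)
    (hζ : orderOf ζ = n) :
    ((setT K L r₁ ζ).ncard : ℤ) = ∑ d ∈ r₁.divisors with d.Coprime n,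
      ArithmeticFunction.moebius d * ((Fintype.card K : ℤ) ^ (r₁ / d) - 1) := by
  have : Finite L := Module.finite_of_finite K
  have hr0 : r₁ ≠ 0 := by
    rintro rfl
    have := Module.finrank_pos (R := K) (M := L)
    omega
  set B : Set L := {y | y ≠ 0 ∧ y ^ Fintype.card K ^ r₁ = algebraMap K L ζ * y} with hB
  have hTB : setT K L r₁ ζ = B ∩ fullDegree K L := Set.ext fun y => mem_setT_iff hr0 ζ y
  rw [hTB, ncard_inter_fullDegree B hr]
  · refine Finset.sum_congr rfl fun d hd => ?_
    rw [Finset.mem_filter, Nat.mem_divisors] at hd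
    obtain ⟨⟨hdr, -⟩, hdn⟩ := hd
    congr 1
    have hs0 : r₁ / d ≠ 0 :=
      (Nat.div_ne_zero_iff_of_dvd hdr).2 ⟨hr0, ne_zero_of_dvd_ne_zero hr0 hdr⟩
    have hsd : r₁ / d * d = r₁ := Nat.div_mul_cancel hdr
    have hcount := ncard_inter_subfield (L := L) (C (ζ : K) * X) (natDegree_C_mul_le _ _ |>.trans natDegree_X_le) hs0
      (n := n) (d := d) ⟨d, by rw [← hr, mul_right_comm, hsd]⟩
      (by rw [iterate_comp_C_mul_X, ← hζ, ← Units.val_pow_eq_pow_val, pow_orderOf_eq_one]; simp)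
      hdn hn
    rw [hsd] at hcount
    -- Zero solves the scaling equation but is not in `B`; this accounts for the `- 1` in each
    -- summand.
    have hdiff : {y | y ∈ B ∧ y ^ Fintype.card K ^ (r₁ / d * n) = y} =
        {y : L | y ^ Fintype.card K ^ r₁ = aeval y (C (ζ : K) * X) ∧
          y ^ Fintype.card K ^ (r₁ / d * n) = y} \ {0} := by
      ext y
      simp only [hB, Set.mem_ofPred_eq, Set.mem_sdiff, Set.mem_singleton_iff, map_mul, aeval_C,
        aeval_X]
      tauto
    have h0 : (0 : L) ∈ {y : L | y ^ Fintype.card K ^ r₁ = aeval y (C (ζ : K) * X) ∧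
          y ^ Fintype.card K ^ (r₁ / d * n) = y} := by
      simp [zero_pow]
    rw [hdiff, Set.ncard_sdiff_singleton_of_mem h0, hcount, Nat.cast_sub (Nat.one_le_pow _ _ Fintype.card_pos)]
    push_cast
    rfl
  · rintro y ⟨hy0, hy⟩ k hk
    rw [← hζ, orderOf_dvd_iff_pow_eq_one]
    exact Units.ext (by simpa using pow_eq_one_of_eigen hy0 hy hk)

theorem ncard_setU {p r₁ : ℕ} [CharP K p] (hp : p.Prime) (hr : r₁ * p = Module.finrank K L) :
    ((setU K L r₁).ncard : ℤ) = ∑ d ∈ r₁.divisors with ¬ p ∣ d,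
      ArithmeticFunction.moebius d * (Fintype.card K : ℤ) ^ (r₁ / d) := by
  have hr0 : r₁ ≠ 0 := by
    rintro rfl
    have := Module.finrank_pos (R := K) (M := L)
    omega
  set B : Set L := {y | y ^ Fintype.card K ^ r₁ = y + 1} with hB
  have hUB : setU K L r₁ = B ∩ fullDegree K L := Set.ext fun y => mem_setU_iff r₁ y
  have hcop : ∀ d : ℕ, d.Coprime p ↔ ¬ p ∣ d := fun d => by
    rw [Nat.coprime_comm, hp.coprime_iff_not_dvd]
  rw [hUB, ncard_inter_fullDegree B hr]
  · simp_rw [hcop]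
    refine Finset.sum_congr rfl fun d hd => ?_
    rw [Finset.mem_filter, Nat.mem_divisors] at hd
    obtain ⟨⟨hdr, -⟩, hdn⟩ := hd
    have hs0 : r₁ / d ≠ 0 :=
      (Nat.div_ne_zero_iff_of_dvd hdr).2 ⟨hr0, ne_zero_of_dvd_ne_zero hr0 hdr⟩
    have hsd : r₁ / d * d = r₁ := Nat.div_mul_cancel hdr
    have hcount := ncard_inter_subfield (L := L) (X + C (1 : K)) (natDegree_X_add_C _).le hs0
      (n := p) (d := d) ⟨d, by rw [← hr, mul_right_comm, hsd]⟩
      (by rw [iterate_comp_X_add_C, CharP.cast_eq_zero]; simp) ((hcop d).2 hdn) hp.one_lt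
    rw [hsd] at hcount
    rw [← Nat.cast_pow, ← hcount]
    simp [hB]
  · intro y hy k hk
    have := natCast_mul_eq_zero_of_translate (b := (1 : K)) (by simpa [hB] using hy) hk
    rwa [mul_one, CharP.cast_eq_zero_iff K p] at this

end Eigen

/-! ### Affine sets and their normal representatives -/

section AffineSets

variable {K L : Type*} [Field K] [Field L] [Algebra K L]

theorem mem_affineSet_self (α : L) : α ∈ affineSet K α := ⟨1, 0, one_ne_zero, by simp⟩

theorem affineSet_subset {α β : L} (h : β ∈ affineSet K α) : affineSet K β ⊆ affineSet K α := by
  obtain ⟨a, b, ha, rfl⟩ := h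
  rintro _ ⟨c, d, hc, rfl⟩
  refine ⟨c * a, c * b + d, mul_ne_zero hc ha, ?_⟩
  simp only [map_mul, map_add]
  ring

theorem mem_affineSet_symm {α β : L} (h : β ∈ affineSet K α) : α ∈ affineSet K β := by
  obtain ⟨a, b, ha, rfl⟩ := h
  refine ⟨a⁻¹, -(a⁻¹ * b), inv_ne_zero ha, ?_⟩
  have ha' : algebraMap K L a ≠ 0 := (_root_.map_ne_zero _).2 ha
  simp only [map_neg, map_mul, map_inv₀]
  field_simp
  ring

theorem affineSet_eq_iff {α β : L} : affineSet K β = affineSet K α ↔ β ∈ affineSet K α :=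
  ⟨fun h => h ▸ mem_affineSet_self β,
    fun h => (affineSet_subset h).antisymm (affineSet_subset (mem_affineSet_symm h))⟩

theorem image_affineSet (τ : Gal(L/K)) (α : L) : τ '' affineSet K α = affineSet K (τ α) := by
  ext x
  constructor
  · rintro ⟨_, ⟨a, b, ha, rfl⟩, rfl⟩
    exact ⟨a, b, ha, by simp⟩
  · rintro ⟨a, b, ha, rfl⟩
    exact ⟨_, ⟨a, b, ha, rfl⟩, by simp⟩

variable [FiniteDimensional K L]

omit [FiniteDimensional K L] in
theorem notMem_range_of_mem_fullDegree (hr : 2 ≤ Module.finrank K L) {α : L}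
    (hα : α ∈ fullDegree K L) (c : K) : α ≠ algebraMap K L c := by
  rintro rfl
  have h : (minpoly K (algebraMap K L c)).natDegree = _ := hα
  rw [minpoly.eq_X_sub_C, natDegree_X_sub_C] at h
  omega

omit [FiniteDimensional K L] in
theorem affine_injective (hr : 2 ≤ Module.finrank K L) {α : L} (hα : α ∈ fullDegree K L)
    {a b c d : K} (h : algebraMap K L a * α + algebraMap K L b =
      algebraMap K L c * α + algebraMap K L d) : a = c ∧ b = d := by
  by_cases hac : a = c
  · subst hac
    exact ⟨rfl, (algebraMap K L).injective (add_left_cancel h)⟩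
  · have hac' : algebraMap K L (a - c) ≠ 0 := (_root_.map_ne_zero _).2 (sub_ne_zero.2 hac)
    refine absurd ?_ (notMem_range_of_mem_fullDegree hr hα ((d - b) / (a - c)))
    rw [map_div₀, eq_div_iff hac', map_sub, map_sub]
    linear_combination h

variable [Fintype K]

theorem mem_fullDegree_of_mem_affineSet {α β : L} (hα : α ∈ fullDegree K L)
    (hβ : β ∈ affineSet K α) : β ∈ fullDegree K L := by
  have key : ∀ {x y : L}, y ∈ affineSet K x →
      Function.minimalPeriod (frob K L) y ∣ Function.minimalPeriod (frob K L) x := by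
    rintro x _ ⟨a, b, -, rfl⟩
    rw [minimalPeriod_dvd_iff, pow_card_pow_affine, (minimalPeriod_dvd_iff K L x _).1 dvd_rfl]
  rw [mem_fullDegree_iff] at hα ⊢
  rw [← hα]
  exact Nat.dvd_antisymm (key hβ) (key (mem_affineSet_symm hβ))

open scoped Pointwise in
theorem mem_fixedAffineSets_iff (s : ℕ) (Y : Set L) :
    Y ∈ fixedAffineSets K L s ↔ ∃ α ∈ fullDegree K L, Y = affineSet K α ∧
      α ^ Fintype.card K ^ s ∈ affineSet K α := by
  have hfix : (∀ τ ∈ Subgroup.zpowers (frob K L ^ s), τ '' Y = Y) ↔ (frob K L ^ s) '' Y = Y := by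
    constructor
    · exact fun h => h _ (Subgroup.mem_zpowers _)
    · intro h τ hτ
      have hle : Subgroup.zpowers (frob K L ^ s) ≤ MulAction.stabilizer (Gal(L/K)) Y := by
        rw [Subgroup.zpowers_le]
        exact h
      exact hle hτ
  change Y ∈ affineSets K L ∧ _ ↔ _
  rw [hfix]
  constructor
  · rintro ⟨⟨α, hα, rfl⟩, h⟩
    rw [image_affineSet, affineSet_eq_iff, frob_pow_apply] at h
    exact ⟨α, hα, rfl, h⟩
  · rintro ⟨α, hα, rfl, h⟩
    refine ⟨⟨α, hα, rfl⟩, ?_⟩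
    rwa [image_affineSet, affineSet_eq_iff, frob_pow_apply]

theorem affineSet_mem_fixedAffineSets {s : ℕ} {α : L} (hα : α ∈ fullDegree K L) {a b : K}
    (ha : a ≠ 0) (h : α ^ Fintype.card K ^ s = algebraMap K L a * α + algebraMap K L b) :
    affineSet K α ∈ fixedAffineSets K L s :=
  (mem_fixedAffineSets_iff s _).2 ⟨α, hα, rfl, a, b, ha, h⟩

/-- A fixed affine set has a representative on which `σ ^ r₁` is a scaling or the translation
by one. -/
theorem exists_normal_representative {r₁ n : ℕ} (hr : r₁ * n = Module.finrank K L) (hn : 1 < n)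
    (hr2 : 2 ≤ Module.finrank K L) {Y : Set L} (hY : Y ∈ fixedAffineSets K L r₁) :
    ∃ α ∈ fullDegree K L, Y = affineSet K α ∧
      ((∃ ζ : Kˣ, orderOf ζ = n ∧ α ^ Fintype.card K ^ r₁ = algebraMap K L ζ * α) ∨
        ((n : K) = 0 ∧ α ^ Fintype.card K ^ r₁ = α + 1)) := by
  have hr0 : 0 < r₁ := Nat.pos_of_ne_zero (by rintro rfl; omega)
  have hper : ∀ {x : L}, x ^ Fintype.card K ^ (r₁ * n) = x := fun {x} => by
    rw [hr, pow_card_pow_finrank]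
  have hdvd : ∀ {x : L}, x ∈ fullDegree K L → ∀ k, x ^ Fintype.card K ^ (r₁ * k) = x → n ∣ k := by
    intro x hx k hk
    rwa [← minimalPeriod_dvd_iff, (mem_fullDegree_iff K L x).1 hx, ← hr,
      Nat.mul_dvd_mul_iff_left hr0] at hk
  obtain ⟨α, hα, rfl, a, b, ha, hab⟩ := (mem_fixedAffineSets_iff r₁ Y).1 hY
  by_cases ha1 : a = 1
  · subst ha1
    rw [map_one, one_mul] at hab
    -- With `b = 0` the period of `α` would divide `r₁`, a proper divisor of the degree.
    have hb : b ≠ 0 := by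
      rintro rfl
      rw [map_zero, add_zero] at hab
      have := hdvd hα 1 (by rwa [mul_one])
      exact absurd (Nat.dvd_one.1 this) hn.ne'
    have hβ : algebraMap K L b⁻¹ * α + algebraMap K L 0 ∈ affineSet K α :=
      ⟨b⁻¹, 0, inv_ne_zero hb, rfl⟩
    refine ⟨_, mem_fullDegree_of_mem_affineSet hα hβ, (affineSet_eq_iff.2 hβ).symm, Or.inr ⟨?_, ?_⟩⟩
    · exact (mul_eq_zero.1 (natCast_mul_eq_zero_of_translate hab hper)).resolve_right hb
    · rw [pow_card_pow_affine, hab, mul_add, ← map_mul, inv_mul_cancel₀ hb, map_one, map_zero]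
      ring
  · have ha1' : a - 1 ≠ 0 := sub_ne_zero.2 ha1
    -- The map `x ↦ a x + b` fixes `-b / (a - 1)`; subtracting this point turns it into scaling by
    -- `a`.
    have hβ : algebraMap K L 1 * α + algebraMap K L (b / (a - 1)) ∈ affineSet K α :=
      ⟨1, _, one_ne_zero, rfl⟩
    have hβS := mem_fullDegree_of_mem_affineSet hα hβ
    have heig : (algebraMap K L 1 * α + algebraMap K L (b / (a - 1))) ^ Fintype.card K ^ r₁ =
        algebraMap K L a * (algebraMap K L 1 * α + algebraMap K L (b / (a - 1))) := by
      have hid : b + b / (a - 1) = a * (b / (a - 1)) := by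
        field_simp
        ring
      have hid' := congrArg (algebraMap K L) hid
      rw [map_add, map_mul] at hid'
      rw [pow_card_pow_affine, hab, map_one]
      linear_combination hid'
    have hβ0 : algebraMap K L 1 * α + algebraMap K L (b / (a - 1)) ≠ 0 := by
      simpa using notMem_range_of_mem_fullDegree hr2 hβS 0
    refine ⟨_, hβS, (affineSet_eq_iff.2 hβ).symm, Or.inl ⟨Units.mk0 a ha, ?_, heig⟩⟩
    refine Nat.dvd_antisymm (orderOf_dvd_of_pow_eq_one (Units.ext ?_)) (hdvd hβS _ ?_)
    · simpa using pow_eq_one_of_eigen hβ0 heig hper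
    · rw [pow_card_pow_mul_of_eigen heig]
      have := congrArg Units.val (pow_orderOf_eq_one (Units.mk0 a ha))
      rw [Units.val_pow_eq_pow_val, Units.val_mk0, Units.val_one] at this
      rw [this]
      simp

end AffineSets

/-! ### Fibres of `α ↦ A(α)` -/

section Fibres

theorem ncard_eq_mul_of_fibres {A B : Type*} [Finite A] [Finite B] (f : A → B) (W : Set A)
    (Y : Set B) (k : ℕ) (hmaps : ∀ x ∈ W, f x ∈ Y)
    (hfib : ∀ y ∈ Y, {x | x ∈ W ∧ f x = y}.ncard = k) : W.ncard = Y.ncard * k := by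
  classical
  have := Fintype.ofFinite A
  have := Fintype.ofFinite B
  rw [Set.ncard_eq_toFinset_card' W, Set.ncard_eq_toFinset_card' Y,
    Finset.card_eq_sum_card_fiberwise (f := f) (t := Y.toFinset), Finset.sum_const_nat]
  · intro y hy
    rw [← hfib y (Set.mem_toFinset.1 hy), Set.ncard_eq_toFinset_card']
    congr 1
    ext
    simp
  · intro x hx
    simpa using hmaps x (by simpa using hx)

variable {K L : Type*} [Field K] [Fintype K] [Field L] [Algebra K L] [FiniteDimensional K L]

/-- Since `σ ^ r` is the identity, every affine set is fixed, and each is parametrized injectively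
by the pairs `(a, b)`. -/
theorem ncard_fullDegree (hr2 : 2 ≤ Module.finrank K L) :
    (fullDegree K L).ncard = (fixedAffineSets K L (Module.finrank K L)).ncard *
      ((Fintype.card K - 1) * Fintype.card K) := by
  classical
  have : Finite L := Module.finite_of_finite K
  refine ncard_eq_mul_of_fibres (affineSet K) _ _ _ ?_ ?_
  · intro α hα
    exact affineSet_mem_fixedAffineSets hα (a := 1) (b := 0) one_ne_zero
      (by simp [pow_card_pow_finrank])
  · intro Y hY
    obtain ⟨α, hα, rfl, -⟩ := (mem_fixedAffineSets_iff _ Y).1 hY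
    have hinj : Function.Injective fun u : Kˣ × K =>
        algebraMap K L u.1 * α + algebraMap K L u.2 := by
      rintro ⟨a, b⟩ ⟨c, d⟩ h
      obtain ⟨h1, h2⟩ := affine_injective hr2 hα h
      exact Prod.ext (Units.ext h1) h2
    have hset : {x | x ∈ fullDegree K L ∧ affineSet K x = affineSet K α} =
        Set.range fun u : Kˣ × K => algebraMap K L u.1 * α + algebraMap K L u.2 := by
      ext x
      rw [Set.mem_ofPred_eq, affineSet_eq_iff]
      constructor
      · rintro ⟨-, a, b, ha, rfl⟩
        exact ⟨(Units.mk0 a ha, b), rfl⟩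
      · rintro ⟨⟨a, b⟩, rfl⟩
        have hx : algebraMap K L a * α + algebraMap K L b ∈ affineSet K α :=
          ⟨a, b, a.ne_zero, rfl⟩
        exact ⟨mem_fullDegree_of_mem_affineSet hα hx, hx⟩
    rw [hset, Set.ncard_range_of_injective hinj, Nat.card_prod, Nat.card_units,
      Nat.card_eq_fintype_card]

/-- The sets for different `ξ` are disjoint, because a nonzero `y` determines its eigenvalue. They
are equinumerous, because the size formula depends only on the order. The cyclic group `Kˣ` has
`φ(n)` elements of order `n`. -/
theorem ncard_setT_eq_sum {r₁ n : ℕ} (hr : r₁ * n = Module.finrank K L) (hn : 1 < n)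
    (ζ : Kˣ) (hζ : orderOf ζ = n) :
    {y : L | ∃ ξ : Kˣ, orderOf ξ = n ∧ y ∈ setT K L r₁ ξ}.ncard =
      n.totient * (setT K L r₁ ζ).ncard := by
  classical
  have : Finite L := Module.finite_of_finite K
  have := Fintype.ofFinite L
  have hr0 : r₁ ≠ 0 := by
    rintro rfl
    have := Module.finrank_pos (R := K) (M := L)
    omega
  have hset : {y : L | ∃ ξ : Kˣ, orderOf ξ = n ∧ y ∈ setT K L r₁ ξ} =
      (((Finset.univ.filter fun ξ : Kˣ => orderOf ξ = n).biUnion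
        fun ξ => (setT K L r₁ ξ).toFinset : Finset L) : Set L) := by
    ext y
    simp
  rw [hset, Set.ncard_coe_finset, Finset.card_biUnion, Finset.sum_const_nat
    (m := (setT K L r₁ ζ).ncard), ← IsCyclic.card_orderOf_eq_totient (α := Kˣ) (d := n)]
  · rw [← hζ]
    exact orderOf_dvd_card
  · intro ξ hξ
    rw [← Set.ncard_eq_toFinset_card', ← Int.natCast_inj,
      ncard_setT hr hn ξ (Finset.mem_filter.1 hξ).2, ncard_setT hr hn ζ hζ]
  · intro ξ _ ξ' _ hne
    rw [Function.onFun, Set.disjoint_toFinset, Set.disjoint_left]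
    intro y hy hy'
    rw [mem_setT_iff hr0] at hy hy'
    refine hne (Units.ext ((algebraMap K L).injective (mul_right_cancel₀ hy.1.1 ?_)))
    rw [← hy.1.2, hy'.1.2]

theorem ncard_fixedAffineSets_of_dvd {r₁ n : ℕ} (hr : r₁ * n = Module.finrank K L) (hn : 1 < n)
    (hr2 : 2 ≤ Module.finrank K L) (hnK : (n : K) ≠ 0) :
    {y : L | ∃ ξ : Kˣ, orderOf ξ = n ∧ y ∈ setT K L r₁ ξ}.ncard =
      (fixedAffineSets K L r₁).ncard * (Fintype.card K - 1) := by
  classical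
  have : Finite L := Module.finite_of_finite K
  have hr0 : r₁ ≠ 0 := by
    rintro rfl
    omega
  have hne0 : ∀ {x : L}, x ∈ fullDegree K L → x ≠ 0 := fun {x} hx => by
    simpa using notMem_range_of_mem_fullDegree hr2 hx 0
  refine ncard_eq_mul_of_fibres (affineSet K) _ _ _ ?_ ?_
  · rintro α ⟨ξ, -, hα⟩
    rw [mem_setT_iff hr0] at hα
    exact affineSet_mem_fixedAffineSets hα.2 ξ.ne_zero (b := 0) (by rw [hα.1.2]; simp)
  · intro Y hY
    obtain ⟨α, hα, rfl, ⟨ζ, hζ, hαζ⟩ | ⟨h, -⟩⟩ := exists_normal_representative hr hn hr2 hY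
    swap
    · exact absurd h hnK
    have hinj : Function.Injective fun u : Kˣ => algebraMap K L u * α := fun a b h =>
      Units.ext ((algebraMap K L).injective (mul_right_cancel₀ (hne0 hα) h))
    have hset : {x | x ∈ {y : L | ∃ ξ : Kˣ, orderOf ξ = n ∧ y ∈ setT K L r₁ ξ} ∧
        affineSet K x = affineSet K α} = Set.range fun u : Kˣ => algebraMap K L u * α := by
      ext x
      rw [Set.mem_ofPred_eq, affineSet_eq_iff]
      constructor
      · rintro ⟨⟨ξ, hξ, hx⟩, c, d, hc, rfl⟩
        rw [mem_setT_iff hr0, pow_card_pow_affine, hαζ] at hx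
        have h : algebraMap K L (c * ζ) * α + algebraMap K L d =
            algebraMap K L (ξ * c) * α + algebraMap K L (ξ * d) := by
          rw [map_mul, map_mul, map_mul]
          linear_combination hx.1.2
        obtain ⟨h1, h2⟩ := affine_injective hr2 hα h
        -- Comparing constant terms gives `d = ξ d`, so `ξ ≠ 1` rules out any translation part.
        have hξ1 : (ξ : K) ≠ 1 := by
          intro h
          rw [Units.val_eq_one] at h
          rw [h, orderOf_one] at hξ
          omega
        have hd : d = 0 := by
          by_contra hd
          exact hξ1 ((mul_eq_right₀ hd).1 h2.symm)
        exact ⟨Units.mk0 c hc, by simp [hd]⟩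
      · rintro ⟨u, rfl⟩
        have hx : algebraMap K L u * α ∈ affineSet K α := ⟨u, 0, u.ne_zero, by simp⟩
        have hxS := mem_fullDegree_of_mem_affineSet hα hx
        refine ⟨⟨ζ, hζ, (mem_setT_iff hr0 _ _).2 ⟨⟨hne0 hxS, ?_⟩, hxS⟩⟩, hx⟩
        have := pow_card_pow_affine (u : K) 0 α r₁
        rw [map_zero, add_zero, add_zero] at this
        rw [this, hαζ]
        ring
    rw [hset, Set.ncard_range_of_injective hinj, Nat.card_units, Nat.card_eq_fintype_card]

theorem ncard_setU_eq_mul {p r₁ : ℕ} [CharP K p] (hp : p.Prime)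
    (hr : r₁ * p = Module.finrank K L) (hr2 : 2 ≤ Module.finrank K L) :
    (setU K L r₁).ncard = (fixedAffineSets K L r₁).ncard * Fintype.card K := by
  classical
  have : Finite L := Module.finite_of_finite K
  refine ncard_eq_mul_of_fibres (affineSet K) _ _ _ ?_ ?_
  · intro α hα
    rw [mem_setU_iff] at hα
    exact affineSet_mem_fixedAffineSets hα.2 (a := 1) (b := 1) one_ne_zero (by rw [hα.1]; simp)
  · intro Y hY
    obtain ⟨α, hα, rfl, ⟨ζ, hζ, -⟩ | ⟨-, hα1⟩⟩ := exists_normal_representative hr hp.one_lt hr2 hY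
    · exfalso
      -- A scaling representative would have eigenvalue of order `p`, so `p` would divide both `q -
      -- 1` and `q`.
      have h1 : p ∣ Fintype.card K - 1 := by
        rw [← hζ, ← Fintype.card_units]
        exact orderOf_dvd_card
      have h2 : p ∣ Fintype.card K :=
        (CharP.cast_eq_zero_iff K p _).1 (FiniteField.cast_card_eq_zero K)
      have h3 := (Nat.dvd_sub_iff_right Fintype.card_pos h2).1 h1
      exact hp.one_lt.ne' (Nat.dvd_one.1 h3)
    · have hinj : Function.Injective fun d : K => α + algebraMap K L d := fun a b h =>
        (algebraMap K L).injective (add_left_cancel h)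
      have hset : {x | x ∈ setU K L r₁ ∧ affineSet K x = affineSet K α} =
          Set.range fun d : K => α + algebraMap K L d := by
        ext x
        rw [Set.mem_ofPred_eq, affineSet_eq_iff]
        constructor
        · rintro ⟨hx, c, d, hc, rfl⟩
          rw [mem_setU_iff, pow_card_pow_affine, hα1] at hx
          -- Scaling by `c` multiplies the translation by `c`, so only `c = 1` keeps it equal to
          -- one.
          have hc1 : algebraMap K L c = 1 := by linear_combination hx.1
          exact ⟨d, by rw [hc1, one_mul]⟩
        · rintro ⟨d, rfl⟩
          have hx : α + algebraMap K L d ∈ affineSet K α := ⟨1, d, one_ne_zero, by simp⟩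
          refine ⟨(mem_setU_iff _ _).2 ⟨?_, mem_fullDegree_of_mem_affineSet hα hx⟩, hx⟩
          have := pow_card_pow_affine 1 d α r₁
          rw [map_one, one_mul, one_mul] at this
          rw [this, hα1]
          ring
      rw [hset, Set.ncard_range_of_injective hinj, Nat.card_eq_fintype_card]

end Fibres

end GoppaAffine

/-! ### Assembly of the counts -/

theorem mainTheorem3 {K L : Type*} [Field K] [Fintype K] [Field L] [Algebra K L]
    [FiniteDimensional K L] (p t q r : ℕ) (hp : p.Prime) (hqp : q = p ^ t)
    (hq : Fintype.card K = q) (hr : Module.finrank K L = r) (hr2 : 2 ≤ r) :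
    (((GoppaAffine.fixedAffineSets K L r).ncard : ℚ) =
      ((GoppaAffine.fullDegree K L).ncard : ℚ) / ((q : ℚ) ^ 2 - q)) ∧
    (∀ r₁ rbar : ℕ, r₁ * rbar = r →
      (1 < rbar → rbar ∣ q - 1 →
        (∃ ζ : Kˣ, orderOf ζ = rbar) ∧
        ∀ ζ : Kˣ, orderOf ζ = rbar →
          ((GoppaAffine.fixedAffineSets K L r₁).ncard : ℚ) =
            (Nat.totient rbar : ℚ) * ((GoppaAffine.setT K L r₁ ζ).ncard : ℚ) / ((q : ℚ) - 1) ∧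
          ((GoppaAffine.setT K L r₁ ζ).ncard : ℤ) =
            ∑ d ∈ r₁.divisors with Nat.Coprime d rbar,
              ArithmeticFunction.moebius d * ((q : ℤ) ^ (r₁ / d) - 1)) ∧
      (Nat.gcd rbar r = p →
        (rbar = p →
          ((GoppaAffine.fixedAffineSets K L r₁).ncard : ℚ) =
            ((GoppaAffine.setU K L r₁).ncard : ℚ) / (q : ℚ) ∧
          ((GoppaAffine.setU K L r₁).ncard : ℤ) =
            ∑ d ∈ r₁.divisors with ¬ p ∣ d,
              ArithmeticFunction.moebius d * (q : ℤ) ^ (r₁ / d)) ∧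
        (rbar = r → (GoppaAffine.fixedAffineSets K L r₁).ncard = 1))) := by
  open GoppaAffine in
  subst hr
  have hq1 : 1 < q := hq ▸ Fintype.one_lt_card
  have hqQ : (1 : ℚ) < q := by exact_mod_cast hq1
  have hchar : CharP K p := by
    have : Fact p.Prime := ⟨hp⟩
    exact charP_of_card_eq_prime_pow (hq.trans hqp)
  have hU : ∀ r₁, r₁ * p = Module.finrank K L →
      (((fixedAffineSets K L r₁).ncard : ℚ) = ((setU K L r₁).ncard : ℚ) / (q : ℚ) ∧
        ((setU K L r₁).ncard : ℤ) = ∑ d ∈ r₁.divisors with ¬ p ∣ d,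
          ArithmeticFunction.moebius d * (q : ℤ) ^ (r₁ / d)) := by
    intro r₁ hr
    constructor
    · rw [eq_div_iff (by positivity), ncard_setU_eq_mul hp hr hr2, hq, Nat.cast_mul]
    · rw [ncard_setU hp hr, hq]
  refine ⟨?_, fun r₁ n hrn => ⟨fun hn hnq => ⟨?_, fun ζ hζ => ⟨?_, ?_⟩⟩, fun hgcd => ⟨?_, ?_⟩⟩⟩
  · rw [eq_div_iff (by nlinarith), ncard_fullDegree hr2, hq, Nat.cast_mul, Nat.cast_mul,
      Nat.cast_sub hq1.le, Nat.cast_one]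
    ring
  · obtain ⟨g, hg⟩ := IsCyclic.exists_ofOrder_eq_natCard (α := Kˣ)
    obtain ⟨m, hm⟩ := hnq
    have hcard : orderOf g = n * m := by
      rw [hg, Nat.card_units, Nat.card_eq_fintype_card, hq, hm]
    exact ⟨g ^ m, by
      rw [orderOf_pow_of_dvd (by rintro rfl; omega) (hcard ▸ dvd_mul_left m n), hcard,
        Nat.mul_div_cancel _ (Nat.pos_of_ne_zero (by rintro rfl; omega))]⟩
  · have hnK : (n : K) ≠ 0 := by
      intro h
      obtain ⟨m, hm⟩ := hnq
      have h1 : q = n * m + 1 := by omega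
      have h2 : (q : K) = 0 := hq ▸ FiniteField.cast_card_eq_zero K
      rw [h1, Nat.cast_add, Nat.cast_mul, h, zero_mul, zero_add, Nat.cast_one] at h2
      exact one_ne_zero h2
    have h := ncard_fixedAffineSets_of_dvd hrn hn hr2 hnK
    rw [ncard_setT_eq_sum hrn hn ζ hζ, hq] at h
    rw [eq_div_iff (by linarith), ← Nat.cast_mul, h, Nat.cast_mul, Nat.cast_sub hq1.le,
      Nat.cast_one]
  · rw [ncard_setT hrn hn ζ hζ, hq]
  · rintro rfl
    exact hU r₁ hrn
  · rintro rfl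
    rw [Nat.gcd_self] at hgcd
    -- Here `gcd(r, r) = p` makes the degree `p`, so this is the translation case with `r₁ = 1`.
    -- Only `d = 1` contributes, hence `|U(r)| = q` and the quotient is `1`.
    have hr1 : r₁ = 1 := (mul_eq_right₀ (by omega)).1 hrn
    subst hr1
    obtain ⟨h1, h2⟩ := hU 1 (by rw [one_mul, hgcd])
    have hcard : ((setU K L 1).ncard : ℤ) = q := by
      rw [h2, Nat.divisors_one, Finset.sum_filter, Finset.sum_singleton,
        if_pos (by simpa using hp.one_lt.ne')]
      simp
    have hcard' : (setU K L 1).ncard = q := by exact_mod_cast hcard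
    rw [hcard', div_self (by positivity)] at h1
    exact_mod_cast h1
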